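/- For density matrices $\rho,\sigma$ let $\mathrm{TD}(\rho,\sigma)=\tfrac12\|\rho-\sigma\|_1$, where $\|X\|_1=\mathrm{Tr}\sqrt{X^\dagger X}$. Let $\mathscr H(\mathbb C^N)$ be the Haar measure on states, i.e. the uniform probability measure on the unit sphere of $\mathbb C^N$. For $v\in[N]^t$ let $\mathrm{type}(v)\in\{0,\dots,t\}^N$ be the vector whose $i$-th entry is the number of occurrences of $i$ in $v$, and for such a vector $T$ that occurs as a type let $|\mathrm{type}_T\rangle\in(\mathbb C^N)^{\otimes t}$ be the normalised uniform superposition of the basis states $|v\rangle$ with $v\in[N]^t$ and $\mathrm{type}(v)=T$. (1) There is an absolute constant $C$ such that for all integers $n,t\ge 0$ the following holds. Let $\{\alpha_x\}_{x\in\{0,1\}^n}$ be independent, uniformly random $\pm1$ values and let $|\psi\rangle=2^{-n/2}\sum_{x\in\{0,1\}^n}\alpha_x|x\rangle$. Then $$\mathrm{TD}\Big(\mathbb E\,|\psi\rangle\langle\psi|^{\otimes t},\ \mathbb E_{|\vartheta\rangle\leftarrow\mathscr H(\mathbb C^{2^n})}|\vartheta\rangle\langle\vartheta|^{\otimes t}\Big)\le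 C\,\frac{t^2}{2^n}.$$ (2) There is an absolute constant $C$ such that for all integers $N\ge1$ and $0\le t\le N$, $$\mathrm{TD}\Big(\mathbb E_{T}\,|\mathrm{type}_T\rangle\langle\mathrm{type}_T|,\ \mathbb E_{|\vartheta\rangle\leftarrow\mathscr H(\mathbb C^{N})}|\vartheta\rangle\langle\vartheta|^{\otimes t}\Big)\le C\,\frac{t^2}{N},$$ where $T$ is uniformly random among the vectors in $\{0,1\}^N$ of Hamming weight $t$. -/

import Mathlib

open MeasureTheory ProbabilityTheory
open scoped MatrixOrder

namespace BinaryPhase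

/-- The pure state `|ψ⟩⟨ψ|` as a matrix in the computational basis indexed by `ι`. -/
noncomputable def pureState {ι : Type*} (ψ : EuclideanSpace ℂ ι) : Matrix ι ι ℂ :=
  Matrix.vecMulVec ψ.ofLp (star ψ.ofLp)

/-- The tensor power `ρ^{⊗t}`, a matrix on `(ℂ^ι)^{⊗t}` written in the product basis
`|v 0, …, v (t-1)⟩`, `v : Fin t → ι`. -/
def tensorPower {ι : Type*} (t : ℕ) (ρ : Matrix ι ι ℂ) : Matrix (Fin t → ι) (Fin t → ι) ℂ :=
  Matrix.of fun v w => ∏ i, ρ (v i) (w i)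

/-- The trace norm `Tr √(X† X)`. -/
noncomputable def traceNorm {ι : Type*} [Fintype ι] [DecidableEq ι] (X : Matrix ι ι ℂ) : ℝ :=
  (CFC.sqrt (X.conjTranspose * X)).trace.re

/-- The trace distance `½ ‖ρ - σ‖₁`. -/
noncomputable def traceDist {ι : Type*} [Fintype ι] [DecidableEq ι] (ρ σ : Matrix ι ι ℂ) : ℝ :=
  (1 / 2) * traceNorm (ρ - σ)

/-- The expectation of a random matrix, taken entry by entry. -/
noncomputable def expect {Ω : Type*} [MeasurableSpace Ω] {ι : Type*} (P : Measure Ω)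
    (M : Ω → Matrix ι ι ℂ) : Matrix ι ι ℂ :=
  Matrix.of fun i j => ∫ ω, M ω i j ∂P

/-- The Haar measure on states: the uniform probability measure on the unit sphere of `ℂ^ι`,
that is, the surface measure induced by Lebesgue measure, normalised to total mass one. -/
noncomputable def haarState (ι : Type*) [Fintype ι] :
    Measure (Metric.sphere (0 : EuclideanSpace ℂ ι) 1) :=
  ((volume : Measure (EuclideanSpace ℂ ι)).toSphere Set.univ)⁻¹ •
    (volume : Measure (EuclideanSpace ℂ ι)).toSphere

/-- The mixed state `E |ϑ⟩⟨ϑ|^{⊗t}` of `t` copies of a Haar-random state of `ℂ^ι`. -/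
noncomputable def haarMoment (ι : Type*) [Fintype ι] (t : ℕ) :
    Matrix (Fin t → ι) (Fin t → ι) ℂ :=
  expect (haarState ι) fun θ => tensorPower t (pureState (θ : EuclideanSpace ℂ ι))

/-- The state `2^{-n/2} ∑ₓ αₓ |x⟩` on `n` qubits. -/
noncomputable def binaryPhaseState {n : ℕ} (α : (Fin n → Bool) → ℝ) :
    EuclideanSpace ℂ (Fin n → Bool) :=
  (2 : ℝ) ^ (-(n : ℝ) / 2) • ∑ x, α x • EuclideanSpace.single x (1 : ℂ)

/-- The type of `v ∈ [N]^t`: the vector whose `i`-th entry is the frequency of `i` in `v`. -/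
def typeOf {N t : ℕ} (v : Fin t → Fin N) : Fin N → ℕ :=
  fun i => (Finset.univ.filter fun j => v j = i).card

/-- The set of `v ∈ [N]^t` of type `T`. -/
def ofType {N : ℕ} (t : ℕ) (T : Fin N → ℕ) : Finset (Fin t → Fin N) :=
  Finset.univ.filter fun v => typeOf v = T

/-- The type state `|type_T⟩`: the normalised uniform superposition of all `|v⟩`
with `v ∈ [N]^t` of type `T`. -/
noncomputable def typeState {N : ℕ} (t : ℕ) (T : Fin N → ℕ) :
    EuclideanSpace ℂ (Fin t → Fin N) :=
  (1 / Real.sqrt (ofType t T).card) • ∑ v ∈ ofType t T, EuclideanSpace.single v (1 : ℂ)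

/-- The vectors in `{0,1}^N` of Hamming weight `t`. -/
def binaryTypes (N t : ℕ) : Finset (Fin N → Fin 2) :=
  Finset.univ.filter fun T => hammingNorm T = t

/-- The average of `|type_T⟩⟨type_T|` over `T` uniform in the vectors of `{0,1}^N` of
Hamming weight `t`. -/
noncomputable def typeMixture (N t : ℕ) : Matrix (Fin t → Fin N) (Fin t → Fin N) ℂ :=
  (1 / ((binaryTypes N t).card : ℝ)) •
    ∑ T ∈ binaryTypes N t, pureState (typeState t fun i => (T i : ℕ))

end BinaryPhase

/-! All states involved look alike on collision-free basis vectors. Let `J` (`injBlock`) have entry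
1 at pairs of injective tuples that are rearrangements of each other, and 0 elsewhere. Flipping the
sign of one amplitude kills every entry `(v, w)` in which some symbol occurs an odd number of times
in `v` and `w` together. If `v` is injective and no entry is killed this way, then `w` has the same
length as `v` and must contain each symbol of `v`, so it is a rearrangement of `v`
(`exists_perm_of_even_occ`). On such pairs the entry is the same constant for all injective `v`.
Hence each state is `c • J + R` with `R` positive semidefinite and supported on tuples with a
collision (`eq_smul_add_complPart`).

Since both traces are 1, the coefficients of `J` differ only as far as the remainders have weight,
so the trace distance is at most the sum of the two collision weights (`traceDist_le_of_block`). For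
`t` copies of a random state the birthday bound controls this weight by `t²` times the expected sum
of the fourth powers of the amplitudes. That sum is `2⁻ⁿ` for the phase state and at most `3 / N`
for Haar, the latter from invariance under a Hadamard rotation of two coordinates
(`integral_norm_pow_four_add_le`). The type mixture has no collision weight. This gives the
constants `4 = 1 + 3` and `3 = 0 + 3`. -/

namespace BinaryPhase

/-! ### Trace norm and comparison of states sharing a block. -/

section TraceNorm

open scoped ComplexOrder

variable {ι : Type*}

open Matrix in
/-- The trace norm of a difference of positive semidefinite matrices is at most the sum of their
traces. -/
theorem traceNorm_sub_le [Fintype ι] [DecidableEq ι] {P Q : Matrix ι ι ℂ} (hP : P.PosSemidef) (hQ : Q.PosSemidef) :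
    traceNorm (P - Q) ≤ P.trace.re + Q.trace.re := by
  have hX : (P - Q).IsHermitian := hP.isHermitian.sub hQ.isHermitian
  set U : Matrix ι ι ℂ := (hX.eigenvectorUnitary : Matrix ι ι ℂ) with hU
  have hUU : Uᴴ * U = 1 := Unitary.coe_star_mul_self hX.eigenvectorUnitary
  have hUU' : U * Uᴴ = 1 := Unitary.coe_mul_star_self hX.eigenvectorUnitary
  set D : Matrix ι ι ℂ := diagonal fun i => (hX.eigenvalues i : ℂ) with hD
  set A : Matrix ι ι ℂ := diagonal fun i => ((|hX.eigenvalues i| : ℝ) : ℂ) with hA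
  have hspec : P - Q = U * D * Uᴴ := hX.spectral_theorem
  have hDA : D * D = A * A := by
    rw [hD, hA, diagonal_mul_diagonal, diagonal_mul_diagonal]
    congr 1; funext i
    rw [← Complex.ofReal_mul, ← Complex.ofReal_mul, abs_mul_abs_self]
  have hApos : A.PosSemidef := by
    rw [hA, posSemidef_diagonal_iff]
    intro i
    exact_mod_cast abs_nonneg _
  have conj_mul : ∀ B : Matrix ι ι ℂ, (U * B * Uᴴ) * (U * B * Uᴴ) = U * (B * B) * Uᴴ := by
    intro B
    calc (U * B * Uᴴ) * (U * B * Uᴴ) = U * B * (Uᴴ * U) * B * Uᴴ := by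
          simp only [Matrix.mul_assoc]
      _ = U * (B * B) * Uᴴ := by rw [hUU]; simp only [Matrix.mul_assoc, Matrix.mul_one]
  -- `U * A * Uᴴ` is positive semidefinite with the right square, and such a root is unique.
  have hsqrt : CFC.sqrt ((P - Q).conjTranspose * (P - Q)) = U * A * Uᴴ := by
    refine CFC.sqrt_unique ?_ ?_
    · rw [hX.eq, hspec, conj_mul, conj_mul, hDA]
    · exact (hApos.mul_mul_conjTranspose_same U).nonneg
  have htr : ∀ B : Matrix ι ι ℂ, (U * B * Uᴴ).trace = B.trace := fun B => by
    rw [trace_mul_comm, ← Matrix.mul_assoc, hUU, Matrix.one_mul]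
  have htr' : ∀ B : Matrix ι ι ℂ, (Uᴴ * B * U).trace = B.trace := fun B => by
    rw [trace_mul_comm, ← Matrix.mul_assoc, hUU', Matrix.one_mul]
  have hdiag : Uᴴ * P * U - Uᴴ * Q * U = D := by
    rw [← Matrix.sub_mul, ← Matrix.mul_sub, hspec]
    calc Uᴴ * (U * D * Uᴴ) * U = (Uᴴ * U) * D * (Uᴴ * U) := by simp only [Matrix.mul_assoc]
      _ = D := by rw [hUU, Matrix.one_mul, Matrix.mul_one]
  rw [traceNorm, hsqrt, htr, ← htr' P, ← htr' Q, hA, trace_diagonal, Matrix.trace, Matrix.trace,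
    Complex.re_sum, Complex.re_sum, Complex.re_sum, ← Finset.sum_add_distrib]
  refine Finset.sum_le_sum fun i _ => ?_
  -- In the eigenbasis of `P - Q` each eigenvalue is a difference of two nonnegative diagonal
  -- entries, so its modulus is at most their sum.
  have h1 : (hX.eigenvalues i : ℂ) = (Uᴴ * P * U) i i - (Uᴴ * Q * U) i i := by
    rw [← Matrix.sub_apply, hdiag, hD, diagonal_apply_eq]
  have h2 : hX.eigenvalues i = ((Uᴴ * P * U) i i).re - ((Uᴴ * Q * U) i i).re := by
    rw [← Complex.sub_re, ← h1, Complex.ofReal_re]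
  have h3 : 0 ≤ ((Uᴴ * P * U) i i).re :=
    (Complex.le_def.1 (hP.conjTranspose_mul_mul_same U).diag_nonneg).1
  have h4 : 0 ≤ ((Uᴴ * Q * U) i i).re :=
    (Complex.le_def.1 (hQ.conjTranspose_mul_mul_same U).diag_nonneg).1
  rw [Complex.ofReal_re, h2, diag_apply, diag_apply]
  exact abs_le.2 ⟨by linarith, by linarith⟩

/-- The principal part of a matrix on the complement of `p`. -/
def complPart (p : ι → Prop) [DecidablePred p] (M : Matrix ι ι ℂ) : Matrix ι ι ℂ :=
  Matrix.of fun v w => if p v ∨ p w then 0 else M v w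

theorem complPart_posSemidef [Fintype ι] [DecidableEq ι] (p : ι → Prop) [DecidablePred p] {M : Matrix ι ι ℂ}
    (hM : M.PosSemidef) : (complPart p M).PosSemidef := by
  have h := hM.conjTranspose_mul_mul_same (Matrix.diagonal fun v => if p v then (0 : ℂ) else 1)
  convert h using 1
  ext v w
  by_cases hv : p v <;> by_cases hw : p w <;>
    simp [complPart, Matrix.diagonal_conjTranspose, hv, hw]

theorem trace_complPart [Fintype ι] (p : ι → Prop) [DecidablePred p] (M : Matrix ι ι ℂ) :
    (complPart p M).trace = ∑ v with ¬ p v, M v v := by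
  simp [complPart, Matrix.trace, Finset.sum_filter, ite_not]

/-- Proportionality is only assumed on the rows in `p`; Hermitian symmetry carries it to the columns
in `p`. As `J` vanishes off `p`, the mixed entries of `M` vanish too. -/
theorem eq_smul_add_complPart (p : ι → Prop) [DecidablePred p] {J M : Matrix ι ι ℂ}
    (hM : M.IsHermitian) (hJ : J.IsHermitian) (hJp : ∀ v w, ¬ p v → J v w = 0) {c : ℝ}
    (hc : ∀ v w, p v → M v w = c * J v w) : M = c • J + complPart p M := by
  ext v w
  by_cases hv : p v
  · simp [complPart, hv, hc v w]
  · by_cases hw : p w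
    · have h1 : M v w = c * J v w := by
        rw [← hM.apply v w, ← hJ.apply v w, hc w v hw]; simp
      simp [complPart, hw, h1]
    · simp [complPart, hv, hw, hJp v w hv]

/-- Two states that are proportional to the same positive semidefinite matrix `J` on a block `p`
have a trace distance bounded by their total weights off that block. -/
theorem traceDist_le_of_block [Fintype ι] [DecidableEq ι] (p : ι → Prop) [DecidablePred p] {J M M' : Matrix ι ι ℂ}
    (hM : M.PosSemidef) (hM' : M'.PosSemidef) (hJ : J.PosSemidef)
    (hJp : ∀ v w, ¬ p v → J v w = 0) {c c' : ℝ}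
    (hc : ∀ v w, p v → M v w = c * J v w) (hc' : ∀ v w, p v → M' v w = c' * J v w)
    (htr : M.trace = 1) (htr' : M'.trace = 1) :
    traceDist M M' ≤ (∑ v with ¬ p v, M v v).re + (∑ v with ¬ p v, M' v v).re := by
  have e := eq_smul_add_complPart p hM.isHermitian hJ.isHermitian hJp hc
  have e' := eq_smul_add_complPart p hM'.isHermitian hJ.isHermitian hJp hc'
  have hR := complPart_posSemidef p hM
  have hR' := complPart_posSemidef p hM'
  rw [← trace_complPart, ← trace_complPart]
  set R := complPart p M
  set R' := complPart p M'
  have t : c * J.trace.re + R.trace.re = 1 := by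
    have := congrArg (fun X : Matrix ι ι ℂ => X.trace.re) e
    simpa [htr] using this.symm
  have t' : c' * J.trace.re + R'.trace.re = 1 := by
    have := congrArg (fun X : Matrix ι ι ℂ => X.trace.re) e'
    simpa [htr'] using this.symm
  have r0 : 0 ≤ R.trace.re := (Complex.le_def.1 hR.trace_nonneg).1
  have r0' : 0 ≤ R'.trace.re := (Complex.le_def.1 hR'.trace_nonneg).1
  -- The surplus multiple of `J` goes to the side on which its coefficient is nonnegative, leaving a
  -- difference of two positive semidefinite matrices.
  have key : traceNorm (M - M') ≤ |c - c'| * J.trace.re + R.trace.re + R'.trace.re := by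
    rcases le_total c' c with h | h
    · have hP : ((c - c') • J + R).PosSemidef := (hJ.smul (sub_nonneg.2 h)).add hR
      have := traceNorm_sub_le hP hR'
      have e2 : M - M' = (c - c') • J + R - R' := by
        rw [e, e', sub_smul]; abel
      rw [e2, abs_of_nonneg (sub_nonneg.2 h)]
      simpa using this
    · have hQ : ((c' - c) • J + R').PosSemidef := (hJ.smul (sub_nonneg.2 h)).add hR'
      have := traceNorm_sub_le hR hQ
      have e2 : M - M' = R - ((c' - c) • J + R') := by
        rw [e, e', sub_smul]; abel
      rw [e2, abs_of_nonpos (sub_nonpos.2 h)]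
      have h5 : ((c' - c) • J + R').trace.re = (c' - c) * J.trace.re + R'.trace.re := by simp
      linarith
  have hJ0 : 0 ≤ J.trace.re := (Complex.le_def.1 hJ.trace_nonneg).1
  -- Subtracting the two trace identities gives `(c - c') Tr J = Tr R' - Tr R`. The resulting factor
  -- 2 is absorbed by the `1 / 2` in `traceDist`.
  have habs : |c - c'| * J.trace.re ≤ R.trace.re + R'.trace.re := by
    rcases abs_cases (c - c') with ⟨h, _⟩ | ⟨h, _⟩ <;> rw [h] <;> linarith
  rw [traceDist]
  linarith

end TraceNorm

/-! ### Combinatorics of tuples, the collision-free block and the birthday bound. -/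

section Collision

open scoped ComplexOrder

variable {ι : Type*} [DecidableEq ι] {t : ℕ}

/-- The number of occurrences of `x` in the tuple `v`. -/
def occ (v : Fin t → ι) (x : ι) : ℕ :=
  (Finset.univ.filter fun j => v j = x).card

theorem occ_comp_perm (v : Fin t → ι) (σ : Equiv.Perm (Fin t)) : occ (v ∘ σ) = occ v := by
  funext x
  refine Finset.card_bij (fun j _ => σ j) ?_ ?_ ?_
  · intro a ha; simpa using ha
  · intro a _ b _ h; exact σ.injective h
  · intro b hb; exact ⟨σ.symm b, by simpa using hb, by simp⟩

theorem occ_apply_of_injective {v : Fin t → ι} (hv : Function.Injective v) (i : Fin t) :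
    occ v (v i) = 1 := by
  rw [occ, Finset.card_eq_one]
  exact ⟨i, by ext j; simp [hv.eq_iff]⟩

/-- A tuple whose occurrence numbers have the same parities as those of an injective tuple of the
same length is a rearrangement of it. -/
theorem exists_perm_of_even_occ {v w : Fin t → ι} (hv : Function.Injective v)
    (h : ∀ x, Even (occ v x + occ w x)) : ∃ σ : Equiv.Perm (Fin t), w = v ∘ σ := by
  have hmem : ∀ i, ∃ j, w j = v i := by
    intro i
    have h1 := h (v i)
    rw [occ_apply_of_injective hv] at h1
    have h2 : occ w (v i) ≠ 0 := by
      intro h0; rw [h0] at h1; exact absurd h1 (by decide)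
    obtain ⟨j, hj⟩ := Finset.card_pos.1 (Nat.pos_of_ne_zero h2)
    exact ⟨j, by simpa using hj⟩
  choose g hg using hmem
  -- Choosing a position of each `v i` in `w` is an injective self-map of `Fin t`, hence a
  -- permutation; this uses that the lengths agree.
  have hginj : Function.Injective g := fun a b hab => hv (by rw [← hg a, ← hg b, hab])
  have hgbij := Finite.injective_iff_bijective.1 hginj
  refine ⟨(Equiv.ofBijective g hgbij).symm, funext fun j => ?_⟩
  obtain ⟨i, rfl⟩ := hgbij.2 j
  simp [hg, Equiv.ofBijective_symm_apply_apply]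

/-- The unnormalised sum of the collision-free type states: the matrix with entry one at pairs of
injective tuples with the same range. -/
def injBlock (ι : Type*) [DecidableEq ι] (t : ℕ) :
    Matrix (Fin t → ι) (Fin t → ι) ℂ :=
  open Classical in
  Matrix.of fun v w =>
    if Function.Injective v ∧ Function.Injective w ∧
      Finset.univ.image v = Finset.univ.image w then 1 else 0

/-- The block is a Gram matrix `B * Bᴴ`, with `B` the incidence matrix between injective tuples and
their ranges. -/
theorem injBlock_posSemidef [Fintype ι] : (injBlock ι t).PosSemidef := by
  classical
  let B : Matrix (Fin t → ι) (Finset ι) ℂ := Matrix.of fun v s =>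
    if Function.Injective v ∧ Finset.univ.image v = s then 1 else 0
  have hB : injBlock ι t = B * B.conjTranspose := by
    ext v w
    by_cases hv : Function.Injective v <;> by_cases hw : Function.Injective w <;>
      simp [injBlock, B, Matrix.mul_apply, hv, hw, eq_comm]
  rw [hB]
  exact Matrix.posSemidef_self_mul_conjTranspose B

theorem injBlock_eq_zero {v : Fin t → ι} (hv : ¬ Function.Injective v) (w : Fin t → ι) :
    injBlock ι t v w = 0 := by
  simp [injBlock, hv]

theorem injBlock_comp_perm {v : Fin t → ι} (hv : Function.Injective v)
    (σ : Equiv.Perm (Fin t)) : injBlock ι t v (v ∘ σ) = 1 := by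
  have : Finset.univ.image v = Finset.univ.image (v ∘ σ) := by
    rw [← Finset.image_image, Finset.image_univ_equiv]
  simp [injBlock, hv, hv.comp σ.injective, ← this]

theorem injBlock_eq_zero_of_odd {v w : Fin t → ι} {x : ι} (h : ¬ Even (occ v x + occ w x)) :
    injBlock ι t v w = 0 := by
  rw [injBlock, Matrix.of_apply, if_neg]
  rintro ⟨hv, hw, himg⟩
  have key : ∀ {u : Fin t → ι}, Function.Injective u →
      occ u x = if x ∈ Finset.univ.image u then 1 else 0 := by
    intro u hu
    split_ifs with hx
    · obtain ⟨i, -, rfl⟩ := Finset.mem_image.1 hx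
      exact occ_apply_of_injective hu i
    · rw [occ, Finset.card_eq_zero, Finset.filter_eq_empty_iff]
      rintro j - rfl
      exact hx (Finset.mem_image_of_mem _ (Finset.mem_univ _))
  rw [key hv, key hw, himg] at h
  exact h ⟨_, rfl⟩

/-- A matrix that vanishes between tuples of different parities and is constant on rearrangements
of injective tuples is proportional to `injBlock` there. -/
theorem eq_mul_injBlock {M : Matrix (Fin t → ι) (Fin t → ι) ℂ} {c : ℝ}
    (h0 : ∀ v w x, Function.Injective v → ¬ Even (occ v x + occ w x) → M v w = 0)
    (h1 : ∀ v (σ : Equiv.Perm (Fin t)), Function.Injective v → M v (v ∘ σ) = c)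
    (v w : Fin t → ι) (hv : Function.Injective v) : M v w = c * injBlock ι t v w := by
  by_cases h : ∀ x, Even (occ v x + occ w x)
  · obtain ⟨σ, rfl⟩ := exists_perm_of_even_occ hv h
    rw [h1 v σ hv, injBlock_comp_perm hv, mul_one]
  · obtain ⟨x, hx⟩ := not_forall.1 h
    rw [h0 v w x hv hx, injBlock_eq_zero_of_odd hx, mul_zero]

/-- Two injective tuples of the same length differ by a permutation of the alphabet. -/
theorem exists_perm_comp_eq [Finite ι] {v w : Fin t → ι} (hv : Function.Injective v)
    (hw : Function.Injective w) : ∃ π : Equiv.Perm ι, π ∘ v = w := by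
  classical
  have := Fintype.ofFinite ι
  let e : {x // x ∈ Set.range v} ≃ {x // x ∈ Set.range w} :=
    (Equiv.ofInjective v hv).symm.trans (Equiv.ofInjective w hw)
  refine ⟨e.extendSubtype, funext fun i => ?_⟩
  rw [Function.comp_apply, Equiv.extendSubtype_apply_of_mem e (v i) ⟨i, rfl⟩]
  have h : (Equiv.ofInjective v hv).symm ⟨v i, i, rfl⟩ = i := by
    rw [Equiv.symm_apply_eq]; rfl
  simp [e, h]

theorem sum_prod_filter_eq [Fintype ι] {p : ι → ℝ} (hp1 : ∑ x, p x = 1) {i j : Fin t}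
    (hij : i ≠ j) :
    ∑ v : Fin t → ι with v i = v j, ∏ k, p (v k) = ∑ x, p x ^ 2 := by
  -- The event that positions `i` and `j` both carry `x` is encoded as a product weight, so the sum
  -- over all tuples factorises coordinate by coordinate.
  let q : ι → Fin t → ι → ℝ := fun x k y =>
    p y * if (k = i ∨ k = j) ∧ y ≠ x then 0 else 1
  have h1 : ∀ x, ∏ k, ∑ y, q x k y = p x ^ 2 := by
    intro x
    have h2 : ∀ k, ∑ y, q x k y = if k ∈ ({i, j} : Finset (Fin t)) then p x else 1 := by
      intro k
      by_cases hk : k = i ∨ k = j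
      · simp [q, hk]
      · simp [q, hk, hp1]
    rw [Finset.prod_congr rfl fun k _ => h2 k, Finset.prod_ite_mem, Finset.univ_inter,
      Finset.prod_const, Finset.card_pair hij]
  have h3 : ∀ v : Fin t → ι, (∑ x, ∏ k, q x k (v k)) =
      if v i = v j then ∏ k, p (v k) else 0 := by
    intro v
    have h4 : ∀ x, ∏ k, q x k (v k) = (∏ k, p (v k)) * if v i = x ∧ v j = x then 1 else 0 := by
      intro x
      rw [Finset.prod_mul_distrib]
      congr 1
      split_ifs with h
      · refine Finset.prod_eq_one fun k _ => if_neg ?_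
        rintro ⟨rfl | rfl, h'⟩
        exacts [h' h.1, h' h.2]
      · by_cases hi : v i = x
        · exact Finset.prod_eq_zero (Finset.mem_univ j)
            (if_pos ⟨Or.inr rfl, fun hj => h ⟨hi, hj⟩⟩)
        · exact Finset.prod_eq_zero (Finset.mem_univ i) (if_pos ⟨Or.inl rfl, hi⟩)
    rw [Finset.sum_congr rfl fun x _ => h4 x, ← Finset.mul_sum]
    by_cases h : v i = v j
    · simp [h]
    · rw [if_neg h, Finset.sum_eq_zero, mul_zero]
      intro x _
      exact if_neg fun hx => h (hx.1.trans hx.2.symm)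
  rw [Finset.sum_filter, ← Finset.sum_congr rfl fun v _ => h3 v, Finset.sum_comm]
  refine Finset.sum_congr rfl fun x _ => ?_
  rw [← h1 x, Finset.prod_univ_sum, Fintype.piFinset_univ]

/-- The birthday bound: `t` independent samples from `p` collide with probability at most
`t² ∑ₓ p(x)²`. -/
theorem sum_not_injective_le [Fintype ι] {p : ι → ℝ} (hp : ∀ x, 0 ≤ p x) (hp1 : ∑ x, p x = 1) :
    ∑ v : Fin t → ι with ¬ Function.Injective v, ∏ k, p (v k) ≤ (t : ℝ) ^ 2 * ∑ x, p x ^ 2 := by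
  have hprod : ∀ v : Fin t → ι, 0 ≤ ∏ k, p (v k) := fun v => Finset.prod_nonneg fun k _ => hp _
  calc ∑ v : Fin t → ι with ¬ Function.Injective v, ∏ k, p (v k)
      ≤ ∑ v : Fin t → ι, ∑ ij ∈ (Finset.univ : Finset (Fin t)).offDiag,
          if v ij.1 = v ij.2 then ∏ k, p (v k) else 0 := by
        rw [Finset.sum_filter]
        refine Finset.sum_le_sum fun v _ => ?_
        have h0 : ∀ ij ∈ (Finset.univ : Finset (Fin t)).offDiag,
            0 ≤ if v ij.1 = v ij.2 then ∏ k, p (v k) else 0 := fun ij _ => by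
          split_ifs
          exacts [hprod v, le_rfl]
        split_ifs with hv
        · exact Finset.sum_nonneg h0
        · rw [Function.not_injective_iff] at hv
          obtain ⟨i, j, hij, hne⟩ := hv
          refine le_trans ?_ (Finset.single_le_sum h0 (a := (i, j)) (by simpa using hne))
          simp [hij]
    _ = ∑ ij ∈ (Finset.univ : Finset (Fin t)).offDiag,
          ∑ v : Fin t → ι with v ij.1 = v ij.2, ∏ k, p (v k) := by
        rw [Finset.sum_comm]
        simp only [Finset.sum_filter]
    _ = ((Finset.univ : Finset (Fin t)).offDiag.card : ℝ) * ∑ x, p x ^ 2 := by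
        rw [Finset.sum_congr rfl fun ij hij =>
          sum_prod_filter_eq hp1 (Finset.mem_offDiag.1 hij).2.2, Finset.sum_const, nsmul_eq_mul]
    _ ≤ (t : ℝ) ^ 2 * ∑ x, p x ^ 2 := by
        refine mul_le_mul_of_nonneg_right ?_ (Finset.sum_nonneg fun x _ => sq_nonneg _)
        have : (Finset.univ : Finset (Fin t)).offDiag.card ≤ t ^ 2 := by
          rw [Finset.offDiag_card, Finset.card_univ, Fintype.card_fin, sq]
          exact Nat.sub_le _ _
        exact_mod_cast this

end Collision

/-! ### Moments of a general random state. -/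

section RandomState

open scoped ComplexOrder

variable {ι : Type*} {t : ℕ}

theorem tensorPower_pureState (ψ : EuclideanSpace ℂ ι) :
    tensorPower t (pureState ψ) =
      Matrix.vecMulVec (fun v => ∏ i, ψ (v i)) (star fun v => ∏ i, ψ (v i)) := by
  ext v w
  simp [tensorPower, pureState, Matrix.vecMulVec_apply, Finset.prod_mul_distrib]

theorem tensorPower_pureState_apply (ψ : EuclideanSpace ℂ ι) (v w : Fin t → ι) :
    tensorPower t (pureState ψ) v w = ∏ i, (ψ (v i) * star (ψ (w i))) := by
  simp [tensorPower, pureState, Matrix.vecMulVec_apply]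

theorem continuous_tensorPower_apply (v w : Fin t → ι) :
    Continuous fun θ : EuclideanSpace ℂ ι => tensorPower t (pureState θ) v w := by
  simp only [tensorPower_pureState_apply]
  fun_prop

/-- Rearranging the column index only reorders the conjugated factors, so every amplitude meets its
own conjugate and all phases cancel. -/
theorem tensorPower_pureState_comp_perm (ψ : EuclideanSpace ℂ ι) (v : Fin t → ι)
    (σ : Equiv.Perm (Fin t)) :
    tensorPower t (pureState ψ) v (v ∘ σ) = ((∏ i, ‖ψ (v i)‖ ^ 2 : ℝ) : ℂ) := by
  rw [tensorPower_pureState_apply, Finset.prod_mul_distrib]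
  have : ∏ i, star (ψ ((v ∘ σ) i)) = ∏ i, star (ψ (v i)) :=
    Equiv.prod_comp σ fun i => star (ψ (v i))
  rw [this, ← Finset.prod_mul_distrib, Complex.ofReal_prod]
  refine Finset.prod_congr rfl fun i _ => ?_
  rw [Complex.ofReal_pow]
  exact Complex.mul_conj' _

theorem tensorPower_pureState_self (ψ : EuclideanSpace ℂ ι) (v : Fin t → ι) :
    tensorPower t (pureState ψ) v v = ((∏ i, ‖ψ (v i)‖ ^ 2 : ℝ) : ℂ) :=
  tensorPower_pureState_comp_perm ψ v 1

theorem norm_apply_le_one [Fintype ι] {ψ : EuclideanSpace ℂ ι} (h : ∑ x, ‖ψ x‖ ^ 2 = 1) (x : ι) :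
    ‖ψ x‖ ≤ 1 := by
  have : ‖ψ x‖ ^ 2 ≤ ∑ x, ‖ψ x‖ ^ 2 :=
    Finset.single_le_sum (f := fun x => ‖ψ x‖ ^ 2) (fun _ _ => sq_nonneg _) (Finset.mem_univ x)
  rw [h] at this
  exact (sq_le_one_iff₀ (norm_nonneg _)).1 this

variable {Ω : Type*} [MeasurableSpace Ω] {P : Measure Ω}

theorem expect_posSemidef [Fintype ι] {M : Ω → Matrix ι ι ℂ}
    (hint : ∀ v w, Integrable (fun ω => M ω v w) P) (hM : ∀ ω, (M ω).PosSemidef) :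
    (expect P M).PosSemidef := by
  refine Matrix.PosSemidef.of_dotProduct_mulVec_nonneg ?_ fun x => ?_
  · ext v w
    simp only [Matrix.conjTranspose_apply, expect, Matrix.of_apply, ← starRingEnd_apply]
    rw [← integral_conj]
    refine integral_congr_ae (ae_of_all _ fun ω => ?_)
    exact (hM ω).isHermitian.apply v w
  · have h : star x ⬝ᵥ (expect P M).mulVec x = ∫ ω, star x ⬝ᵥ (M ω).mulVec x ∂P := by
      simp only [dotProduct, Matrix.mulVec, expect, Matrix.of_apply]
      rw [integral_finsetSum]
      · refine Finset.sum_congr rfl fun v _ => ?_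
        rw [integral_const_mul, integral_finsetSum]
        · congr 1
          exact Finset.sum_congr rfl fun w _ => (integral_mul_const _ _).symm
        · exact fun w _ => (hint v w).mul_const _
      · exact fun v _ => (integrable_finsetSum _ fun w _ => (hint v w).mul_const _).const_mul _
    rw [h]
    -- Positivity makes the quadratic form real, which reduces the claim to nonnegativity of a real
    -- integral.
    have h2 : ∀ ω, star x ⬝ᵥ (M ω).mulVec x = ((star x ⬝ᵥ (M ω).mulVec x).re : ℂ) := fun ω =>
      Complex.eq_re_of_ofReal_le (r := 0) (by simpa using (hM ω).dotProduct_mulVec_nonneg x)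
    rw [integral_congr_ae (ae_of_all _ h2), integral_complex_ofReal]
    exact_mod_cast integral_nonneg fun ω =>
      (Complex.le_def.1 ((hM ω).dotProduct_mulVec_nonneg x)).1

variable [Fintype ι] [IsProbabilityMeasure P] {ψ : Ω → EuclideanSpace ℂ ι}

theorem integrable_tensorPower (hm : ∀ x, AEStronglyMeasurable (fun ω => ψ ω x) P)
    (hn : ∀ᵐ ω ∂P, ∑ x, ‖ψ ω x‖ ^ 2 = 1) (v w : Fin t → ι) :
    Integrable (fun ω => tensorPower t (pureState (ψ ω)) v w) P := by
  simp only [tensorPower_pureState_apply]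
  refine Integrable.of_bound (C := 1) ?_ ?_
  · refine Finset.aestronglyMeasurable_fun_prod _ fun i _ => ?_
    exact (hm _).mul (hm _).star
  · filter_upwards [hn] with ω hω
    rw [norm_prod]
    refine Finset.prod_le_one (fun _ _ => norm_nonneg _) fun i _ => ?_
    rw [norm_mul, norm_star]
    exact mul_le_one₀ (norm_apply_le_one hω _) (norm_nonneg _) (norm_apply_le_one hω _)

theorem expect_tensorPower_posSemidef (hm : ∀ x, AEStronglyMeasurable (fun ω => ψ ω x) P)
    (hn : ∀ᵐ ω ∂P, ∑ x, ‖ψ ω x‖ ^ 2 = 1) :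
    (expect P fun ω => tensorPower t (pureState (ψ ω))).PosSemidef := by
  refine expect_posSemidef (integrable_tensorPower hm hn) fun ω => ?_
  rw [tensorPower_pureState]
  exact Matrix.posSemidef_vecMulVec_self_star _

theorem integrable_prod_norm_sq (hm : ∀ x, AEStronglyMeasurable (fun ω => ψ ω x) P)
    (hn : ∀ᵐ ω ∂P, ∑ x, ‖ψ ω x‖ ^ 2 = 1) (v : Fin t → ι) :
    Integrable (fun ω => ∏ i, ‖ψ ω (v i)‖ ^ 2) P := by
  have := (integrable_tensorPower hm hn v v).re
  simpa [tensorPower_pureState_self, -Complex.ofReal_prod] using this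

theorem sum_expect_tensorPower_self (hm : ∀ x, AEStronglyMeasurable (fun ω => ψ ω x) P)
    (hn : ∀ᵐ ω ∂P, ∑ x, ‖ψ ω x‖ ^ 2 = 1) (s : Finset (Fin t → ι)) :
    ∑ v ∈ s, expect P (fun ω => tensorPower t (pureState (ψ ω))) v v =
      ((∫ ω, ∑ v ∈ s, ∏ i, ‖ψ ω (v i)‖ ^ 2 ∂P : ℝ) : ℂ) := by
  rw [integral_finsetSum _ fun v _ => integrable_prod_norm_sq hm hn v, Complex.ofReal_sum]
  refine Finset.sum_congr rfl fun v _ => ?_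
  rw [← integral_complex_ofReal]
  simp only [expect, Matrix.of_apply, tensorPower_pureState_self]

theorem trace_expect_tensorPower (hm : ∀ x, AEStronglyMeasurable (fun ω => ψ ω x) P)
    (hn : ∀ᵐ ω ∂P, ∑ x, ‖ψ ω x‖ ^ 2 = 1) :
    (expect P fun ω => tensorPower t (pureState (ψ ω))).trace = 1 := by
  have h := sum_expect_tensorPower_self hm hn (Finset.univ : Finset (Fin t → ι))
  rw [Matrix.trace]
  refine h.trans ?_
  have : ∫ ω, ∑ v : Fin t → ι, ∏ i, ‖ψ ω (v i)‖ ^ 2 ∂P = ∫ _, 1 ∂P := by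
    refine integral_congr_ae ?_
    filter_upwards [hn] with ω hω
    rw [← Fintype.sum_pow fun x => ‖ψ ω x‖ ^ 2, hω, one_pow]
  rw [this]
  simp

/-- The weight of `t` copies of a random state off the collision-free block, in terms of the fourth
moments of the amplitudes. -/
theorem sum_not_injective_expect_le [DecidableEq ι]
    (hm : ∀ x, AEStronglyMeasurable (fun ω => ψ ω x) P)
    (hn : ∀ᵐ ω ∂P, ∑ x, ‖ψ ω x‖ ^ 2 = 1) :
    (∑ v : Fin t → ι with ¬ Function.Injective v,
      expect P (fun ω => tensorPower t (pureState (ψ ω))) v v).re ≤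
      (t : ℝ) ^ 2 * ∫ ω, ∑ x, ‖ψ ω x‖ ^ 4 ∂P := by
  rw [sum_expect_tensorPower_self hm hn, Complex.ofReal_re, ← integral_const_mul]
  refine integral_mono_ae (integrable_finsetSum _ fun v _ => integrable_prod_norm_sq hm hn v)
    (Integrable.const_mul (integrable_finsetSum _ fun x _ => ?_) _) ?_
  · refine Integrable.of_bound (C := 1) ((hm x).norm.pow 4) ?_
    filter_upwards [hn] with ω hω
    rw [norm_pow, norm_norm]
    exact pow_le_one₀ (norm_nonneg _) (norm_apply_le_one hω x)
  · filter_upwards [hn] with ω hω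
    have := sum_not_injective_le (t := t) (p := fun x => ‖ψ ω x‖ ^ 2) (fun x => sq_nonneg _) hω
    simpa only [← pow_mul] using this

end RandomState

/-! ### Invariance and moments of the Haar measure on states. -/

section Haar

open scoped ComplexOrder Pointwise

variable {ι : Type*} [Fintype ι] {t : ℕ}

instance [Nonempty ι] : IsProbabilityMeasure (haarState ι) := by
  constructor
  rw [haarState, Measure.smul_apply, smul_eq_mul]
  refine ENNReal.inv_mul_cancel ?_ (measure_ne_top _ _)
  rw [Ne, Measure.measure_univ_eq_zero]
  exact Measure.toSphere_ne_zero _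

/-- The restriction of a linear isometry to the unit sphere. -/
noncomputable def sphereMap (U : EuclideanSpace ℂ ι ≃ₗᵢ[ℝ] EuclideanSpace ℂ ι) :
    Metric.sphere (0 : EuclideanSpace ℂ ι) 1 → Metric.sphere (0 : EuclideanSpace ℂ ι) 1 :=
  fun θ => ⟨U θ, by simp⟩

theorem continuous_sphereMap (U : EuclideanSpace ℂ ι ≃ₗᵢ[ℝ] EuclideanSpace ℂ ι) :
    Continuous (sphereMap U) :=
  (U.continuous.comp continuous_subtype_val).subtype_mk _

/-- The surface measure of a set is, up to a fixed factor, the volume of the cone over it, and a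
linear isometry maps cones to cones and preserves volume. -/
theorem measurePreserving_sphereMap (U : EuclideanSpace ℂ ι ≃ₗᵢ[ℝ] EuclideanSpace ℂ ι) :
    MeasurePreserving (sphereMap U) (haarState ι) (haarState ι) := by
  have hmeas := (continuous_sphereMap U).measurable
  have h : MeasurePreserving (sphereMap U) (volume : Measure (EuclideanSpace ℂ ι)).toSphere
      (volume : Measure (EuclideanSpace ℂ ι)).toSphere := by
    refine ⟨hmeas, Measure.ext fun s hs => ?_⟩
    rw [Measure.map_apply hmeas hs, Measure.toSphere_apply' _ hs,
      Measure.toSphere_apply' _ (hmeas hs)]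
    congr 1
    have himg : Set.Ioo (0 : ℝ) 1 • (Subtype.val '' (sphereMap U ⁻¹' s)) =
        U ⁻¹' (Set.Ioo (0 : ℝ) 1 • (Subtype.val '' s)) := by
      ext z
      simp only [Set.mem_smul, Set.mem_image, Set.mem_preimage]
      constructor
      · rintro ⟨r, hr, _, ⟨θ, hθ, rfl⟩, rfl⟩
        exact ⟨r, hr, _, ⟨_, hθ, rfl⟩, by simp [sphereMap]⟩
      · rintro ⟨r, hr, _, ⟨θ, hθ, rfl⟩, hz⟩
        refine ⟨r, hr, _, ⟨sphereMap U.symm θ, ?_, rfl⟩, U.injective ?_⟩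
        · simpa [sphereMap] using hθ
        · simp [sphereMap, ← hz]
    rw [himg]
    exact U.measurePreserving.measure_preimage_emb U.toHomeomorph.measurableEmbedding _
  exact h.smul_measure _

theorem integral_haarState_comp {E : Type*} [NormedAddCommGroup E] [NormedSpace ℝ E]
    (U : EuclideanSpace ℂ ι ≃ₗᵢ[ℝ] EuclideanSpace ℂ ι) (f : EuclideanSpace ℂ ι → E)
    (hf : Continuous f) :
    ∫ θ, f (U (θ : EuclideanSpace ℂ ι)) ∂haarState ι =
      ∫ θ, f (θ : EuclideanSpace ℂ ι) ∂haarState ι := by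
  have h := measurePreserving_sphereMap U
  conv_rhs => rw [← h.map_eq]
  refine Eq.symm ?_
  rw [integral_map (f := fun θ : Metric.sphere (0 : EuclideanSpace ℂ ι) 1 => f θ) h.measurable.aemeasurable
    (hf.comp continuous_subtype_val).aestronglyMeasurable]
  rfl

theorem sum_norm_sq_sphere (θ : Metric.sphere (0 : EuclideanSpace ℂ ι) 1) :
    ∑ x, ‖(θ : EuclideanSpace ℂ ι) x‖ ^ 2 = 1 := by
  rw [← EuclideanSpace.norm_sq_eq, norm_eq_of_mem_sphere, one_pow]

theorem aestronglyMeasurable_sphere_apply (x : ι) :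
    AEStronglyMeasurable (fun θ : Metric.sphere (0 : EuclideanSpace ℂ ι) 1 =>
      (θ : EuclideanSpace ℂ ι) x) (haarState ι) :=
  Continuous.aestronglyMeasurable (by fun_prop)

theorem haarMoment_posSemidef [Nonempty ι] : (haarMoment ι t).PosSemidef :=
  expect_tensorPower_posSemidef aestronglyMeasurable_sphere_apply
    (ae_of_all _ sum_norm_sq_sphere)

theorem trace_haarMoment [Nonempty ι] : (haarMoment ι t).trace = 1 :=
  trace_expect_tensorPower aestronglyMeasurable_sphere_apply (ae_of_all _ sum_norm_sq_sphere)

theorem integrable_haarState [Nonempty ι] {E : Type*} [NormedAddCommGroup E]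
    {f : EuclideanSpace ℂ ι → E} (hf : Continuous f) :
    Integrable (fun θ : Metric.sphere (0 : EuclideanSpace ℂ ι) 1 => f θ) (haarState ι) := by
  have h : Continuous fun θ : Metric.sphere (0 : EuclideanSpace ℂ ι) 1 => f θ :=
    hf.comp continuous_subtype_val
  rw [← integrableOn_univ]
  exact h.continuousOn.integrableOn_compact isCompact_univ

variable [DecidableEq ι]

/-- The isometry that changes the sign of the coordinate `x`. -/
noncomputable def signFlip (x : ι) : EuclideanSpace ℂ ι ≃ₗᵢ[ℝ] EuclideanSpace ℂ ι :=
  LinearIsometryEquiv.piLpCongrRight 2 fun y =>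
    if y = x then LinearIsometryEquiv.neg ℝ else LinearIsometryEquiv.refl ℝ ℂ

theorem signFlip_apply (x : ι) (θ : EuclideanSpace ℂ ι) (y : ι) :
    signFlip x θ y = (if y = x then -1 else 1) * θ y := by
  by_cases h : y = x <;> simp [signFlip, h]

theorem prod_signFlip (x : ι) (θ : EuclideanSpace ℂ ι) (v : Fin t → ι) :
    ∏ i, signFlip x θ (v i) = (-1) ^ occ v x * ∏ i, θ (v i) := by
  simp only [signFlip_apply]
  rw [Finset.prod_mul_distrib, Finset.prod_ite, Finset.prod_const, Finset.prod_const_one, mul_one,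
    occ]

/-- Flipping the sign of coordinate `x` preserves the measure but negates the integrand. -/
theorem haarMoment_eq_zero_of_odd {v w : Fin t → ι} {x : ι} (h : ¬ Even (occ v x + occ w x)) :
    haarMoment ι t v w = 0 := by
  have h1 := integral_haarState_comp (signFlip x) _ (continuous_tensorPower_apply v w)
  have h2 : ∀ θ : EuclideanSpace ℂ ι, tensorPower t (pureState (signFlip x θ)) v w =
      - tensorPower t (pureState θ) v w := by
    intro θ
    rw [tensorPower_pureState, tensorPower_pureState, Matrix.vecMulVec_apply,
      Matrix.vecMulVec_apply, Pi.star_apply, Pi.star_apply, prod_signFlip, prod_signFlip, star_mul,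
      star_pow, star_neg, star_one]
    have h3 : (-1 : ℂ) ^ occ v x * (-1) ^ occ w x = -1 := by
      rw [← pow_add]; exact (Nat.not_even_iff_odd.1 h).neg_one_pow
    linear_combination ((∏ i, θ (v i)) * star (∏ i, θ (w i))) * h3
  simp only [h2] at h1
  rw [integral_neg] at h1
  have h4 : haarMoment ι t v w = - haarMoment ι t v w := h1.symm
  exact CharZero.eq_neg_self_iff.1 h4

theorem exists_haarMoment_eq_mul_injBlock [Nonempty ι] :
    ∃ c : ℝ, ∀ v w : Fin t → ι, Function.Injective v →
      haarMoment ι t v w = c * injBlock ι t v w := by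
  have hself : ∀ (v : Fin t → ι) (σ : Equiv.Perm (Fin t)), haarMoment ι t v (v ∘ σ) =
      ((∫ θ, ∏ i, ‖(θ : EuclideanSpace ℂ ι) (v i)‖ ^ 2 ∂haarState ι : ℝ) : ℂ) := by
    intro v σ
    rw [← integral_complex_ofReal]
    simp only [haarMoment, expect, Matrix.of_apply, tensorPower_pureState_comp_perm]
  have hperm : ∀ v w : Fin t → ι, Function.Injective v → Function.Injective w →
      ∫ θ, ∏ i, ‖(θ : EuclideanSpace ℂ ι) (v i)‖ ^ 2 ∂haarState ι =
      ∫ θ, ∏ i, ‖(θ : EuclideanSpace ℂ ι) (w i)‖ ^ 2 ∂haarState ι := by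
    intro v w hv hw
    -- Permuting coordinates is an isometry, so the diagonal moment is the same for all injective
    -- tuples.
    obtain ⟨π, rfl⟩ := exists_perm_comp_eq hv hw
    rw [← integral_haarState_comp (LinearIsometryEquiv.piLpCongrLeft 2 ℝ ℂ π)
      (fun θ => ∏ i, ‖θ ((π ∘ v) i)‖ ^ 2) (by fun_prop)]
    simp [LinearIsometryEquiv.piLpCongrLeft_apply, Equiv.piCongrLeft'_apply]
  by_cases h : ∃ v : Fin t → ι, Function.Injective v
  · obtain ⟨v₀, hv₀⟩ := h
    refine ⟨∫ θ, ∏ i, ‖(θ : EuclideanSpace ℂ ι) (v₀ i)‖ ^ 2 ∂haarState ι,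
      eq_mul_injBlock (fun v w x _ hx => haarMoment_eq_zero_of_odd hx) fun v σ hv => ?_⟩
    rw [hself, hperm v v₀ hv hv₀]
  · exact ⟨0, fun v _ hv => absurd ⟨v, hv⟩ h⟩

/-! ### The fourth moment via Hadamard rotations. -/

theorem inv_sqrt_two_mul_self : (Real.sqrt 2 : ℂ)⁻¹ * (Real.sqrt 2 : ℂ)⁻¹ = 2⁻¹ := by
  rw [← mul_inv, ← Complex.ofReal_mul, Real.mul_self_sqrt (by norm_num)]
  norm_num

theorem norm_sq_inv_sqrt_two_mul (a : ℂ) : ‖(Real.sqrt 2 : ℂ)⁻¹ * a‖ ^ 2 = 2⁻¹ * ‖a‖ ^ 2 := by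
  rw [norm_mul, mul_pow, norm_inv, Complex.norm_real, inv_pow, Real.norm_eq_abs, sq_abs,
    Real.sq_sqrt (by norm_num)]

theorem norm_sq_hadamard (a b : ℂ) :
    ‖(Real.sqrt 2 : ℂ)⁻¹ * (a + b)‖ ^ 2 + ‖(Real.sqrt 2 : ℂ)⁻¹ * (a - b)‖ ^ 2 =
      ‖a‖ ^ 2 + ‖b‖ ^ 2 := by
  rw [norm_sq_inv_sqrt_two_mul, norm_sq_inv_sqrt_two_mul]
  have := parallelogram_law_with_norm ℝ a b
  linarith

/-- The left side equals `(|a|⁴ + |b|⁴)/2 + |a|²|b|² + 2 Re(a b̄)²`, and `Re(a b̄)² ≤ |a|²|b|²`; the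
gap is twice the square given to `nlinarith`. -/
theorem norm_pow_four_hadamard_le (a b : ℂ) :
    ‖(Real.sqrt 2 : ℂ)⁻¹ * (a + b)‖ ^ 4 + ‖(Real.sqrt 2 : ℂ)⁻¹ * (a - b)‖ ^ 4 ≤
      2⁻¹ * (‖a‖ ^ 4 + ‖b‖ ^ 4) + 3 * (‖a‖ ^ 2 * ‖b‖ ^ 2) := by
  have h4 : ∀ z : ℂ, ‖z‖ ^ 4 = (‖z‖ ^ 2) ^ 2 := fun z => by ring
  simp only [h4, norm_sq_inv_sqrt_two_mul]
  simp only [Complex.sq_norm, Complex.normSq_apply, Complex.add_re,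
    Complex.add_im, Complex.sub_re, Complex.sub_im]
  nlinarith [sq_nonneg (a.re * b.im - a.im * b.re)]

/-- The values of the Hadamard rotation of the coordinates `x` and `y`. -/
noncomputable def hadamardFun {ι : Type*} [DecidableEq ι] (x y : ι) (θ : ι → ℂ) : ι → ℂ := fun z =>
  if z = x then (Real.sqrt 2 : ℂ)⁻¹ * (θ x + θ y)
  else if z = y then (Real.sqrt 2 : ℂ)⁻¹ * (θ x - θ y) else θ z

theorem hadamardFun_left {ι : Type*} [DecidableEq ι] (x y : ι) (θ : ι → ℂ) :
    hadamardFun x y θ x = (Real.sqrt 2 : ℂ)⁻¹ * (θ x + θ y) := if_pos rfl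

theorem hadamardFun_right {ι : Type*} [DecidableEq ι] {x y : ι} (hxy : x ≠ y) (θ : ι → ℂ) :
    hadamardFun x y θ y = (Real.sqrt 2 : ℂ)⁻¹ * (θ x - θ y) := by
  rw [hadamardFun, if_neg hxy.symm, if_pos rfl]

theorem sum_norm_sq_hadamardFun {x y : ι} (hxy : x ≠ y) (θ : ι → ℂ) :
    ∑ z, ‖hadamardFun x y θ z‖ ^ 2 = ∑ z, ‖θ z‖ ^ 2 := by
  rw [← sub_eq_zero, ← Finset.sum_sub_distrib, Fintype.sum_eq_add x y hxy]
  · rw [hadamardFun_left, hadamardFun_right hxy]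
    linarith [norm_sq_hadamard (θ x) (θ y)]
  · rintro z ⟨hx, hy⟩
    simp [hadamardFun, hx, hy]

/-- The Hadamard rotation of the coordinates `x` and `y`. -/
noncomputable def hadamard {x y : ι} (hxy : x ≠ y) :
    EuclideanSpace ℂ ι ≃ₗᵢ[ℝ] EuclideanSpace ℂ ι where
  toLinearEquiv := LinearEquiv.ofInvolutive
    { toFun := fun θ => WithLp.toLp 2 (hadamardFun x y θ)
      map_add' := fun a b => by
        ext z
        simp only [hadamardFun, PiLp.add_apply]
        split_ifs <;> ring
      map_smul' := fun r a => by
        ext z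
        simp only [hadamardFun, PiLp.smul_apply, RingHom.id_apply, Complex.real_smul]
        split_ifs <;> ring }
    (fun a => by
      have h := inv_sqrt_two_mul_self
      ext z
      simp only [hadamardFun, LinearMap.coe_mk, AddHom.coe_mk, if_true, if_neg hxy.symm]
      split_ifs with h1 h2
      · rw [h1]; linear_combination (2 * a x) * h
      · rw [h2]; linear_combination (2 * a y) * h
      · rfl)
  norm_map' := fun a => by
    rw [← sq_eq_sq₀ (norm_nonneg _) (norm_nonneg _), EuclideanSpace.norm_sq_eq,
      EuclideanSpace.norm_sq_eq]
    exact sum_norm_sq_hadamardFun hxy a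

theorem hadamard_apply {x y : ι} (hxy : x ≠ y) (θ : EuclideanSpace ℂ ι) :
    (hadamard hxy θ).ofLp = hadamardFun x y θ := rfl

/-- By invariance the sum `S` of the two fourth moments satisfies `S ≤ S/2 + 3E`, with `E` the mixed
moment, so `S ≤ 6E`. The trivial case `x = y` is included so that the bound can be summed over all
pairs. -/
theorem integral_norm_pow_four_add_le [Nonempty ι] (x y : ι) :
    (∫ θ, ‖(θ : EuclideanSpace ℂ ι) x‖ ^ 4 ∂haarState ι) +
      (∫ θ, ‖(θ : EuclideanSpace ℂ ι) y‖ ^ 4 ∂haarState ι) ≤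
      6 * ∫ θ, ‖(θ : EuclideanSpace ℂ ι) x‖ ^ 2 * ‖(θ : EuclideanSpace ℂ ι) y‖ ^ 2
        ∂haarState ι := by
  have i4 : ∀ z : ι, Integrable (fun θ : Metric.sphere (0 : EuclideanSpace ℂ ι) 1 =>
      ‖(θ : EuclideanSpace ℂ ι) z‖ ^ 4) (haarState ι) := fun z =>
    integrable_haarState (f := fun θ => ‖θ z‖ ^ 4) (by fun_prop)
  have i22 : Integrable (fun θ : Metric.sphere (0 : EuclideanSpace ℂ ι) 1 =>
      ‖(θ : EuclideanSpace ℂ ι) x‖ ^ 2 * ‖(θ : EuclideanSpace ℂ ι) y‖ ^ 2) (haarState ι) :=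
    integrable_haarState (f := fun θ => ‖θ x‖ ^ 2 * ‖θ y‖ ^ 2) (by fun_prop)
  rcases eq_or_ne x y with rfl | hxy
  · have h0 : 0 ≤ ∫ θ, ‖(θ : EuclideanSpace ℂ ι) x‖ ^ 4 ∂haarState ι :=
      integral_nonneg fun θ => by positivity
    simp only [← pow_add]
    norm_num
    linarith
  · have i44 : Integrable (fun θ : Metric.sphere (0 : EuclideanSpace ℂ ι) 1 =>
        ‖(θ : EuclideanSpace ℂ ι) x‖ ^ 4 + ‖(θ : EuclideanSpace ℂ ι) y‖ ^ 4) (haarState ι) :=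
      (i4 x).add (i4 y)
    have hinv := integral_haarState_comp (hadamard hxy) (fun θ => ‖θ x‖ ^ 4 + ‖θ y‖ ^ 4)
      (by fun_prop)
    have hle : ∫ θ, (‖hadamard hxy (θ : EuclideanSpace ℂ ι) x‖ ^ 4 +
        ‖hadamard hxy (θ : EuclideanSpace ℂ ι) y‖ ^ 4) ∂haarState ι ≤
        ∫ θ, (2⁻¹ * (‖(θ : EuclideanSpace ℂ ι) x‖ ^ 4 + ‖(θ : EuclideanSpace ℂ ι) y‖ ^ 4) +
          3 * (‖(θ : EuclideanSpace ℂ ι) x‖ ^ 2 * ‖(θ : EuclideanSpace ℂ ι) y‖ ^ 2))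
          ∂haarState ι := by
      refine integral_mono (integrable_haarState
        (f := fun θ => ‖hadamard hxy θ x‖ ^ 4 + ‖hadamard hxy θ y‖ ^ 4) ?_)
        ((i44.const_mul _).add (i22.const_mul _)) fun θ => ?_
      · have := (hadamard hxy).continuous
        fun_prop
      · simp only [hadamard_apply, hadamardFun_left, hadamardFun_right hxy]
        exact norm_pow_four_hadamard_le _ _
    rw [hinv, integral_add (i44.const_mul _) (i22.const_mul _),
      integral_const_mul, integral_const_mul, integral_add (i4 x) (i4 y)] at hle
    linarith

/-- The fourth moments of the amplitudes of a Haar-random state are of the order of the inverse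
square of the dimension. -/
theorem integral_sum_norm_pow_four_le [Nonempty ι] :
    ∫ θ, ∑ x, ‖(θ : EuclideanSpace ℂ ι) x‖ ^ 4 ∂haarState ι ≤ 3 / Fintype.card ι := by
  have i4 : ∀ z : ι, Integrable (fun θ : Metric.sphere (0 : EuclideanSpace ℂ ι) 1 =>
      ‖(θ : EuclideanSpace ℂ ι) z‖ ^ 4) (haarState ι) := fun z =>
    integrable_haarState (f := fun θ => ‖θ z‖ ^ 4) (by fun_prop)
  have i22 : ∀ x y, Integrable (fun θ : Metric.sphere (0 : EuclideanSpace ℂ ι) 1 =>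
      ‖(θ : EuclideanSpace ℂ ι) x‖ ^ 2 * ‖(θ : EuclideanSpace ℂ ι) y‖ ^ 2) (haarState ι) :=
    fun x y => integrable_haarState (f := fun θ => ‖θ x‖ ^ 2 * ‖θ y‖ ^ 2) (by fun_prop)
  have htot : ∑ x : ι, ∑ y : ι, ∫ θ, ‖(θ : EuclideanSpace ℂ ι) x‖ ^ 2 *
      ‖(θ : EuclideanSpace ℂ ι) y‖ ^ 2 ∂haarState ι = 1 := by
    rw [← Finset.sum_congr rfl fun x _ => integral_finsetSum _ fun y _ => i22 x y,
      ← integral_finsetSum _ fun x _ => integrable_finsetSum _ fun y _ => i22 x y]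
    simp only [← Finset.mul_sum, sum_norm_sq_sphere, mul_one]
    simp
  -- Over all ordered pairs the left side is `2N` times the wanted sum and, by normalisation, the
  -- right side is 6.
  have hsum := Finset.sum_le_sum fun (x : ι) (_ : x ∈ Finset.univ) =>
    Finset.sum_le_sum fun (y : ι) (_ : y ∈ Finset.univ) => integral_norm_pow_four_add_le x y
  simp only [← Finset.mul_sum, Finset.sum_add_distrib, htot, Finset.sum_const, Finset.card_univ,
    nsmul_eq_mul] at hsum
  rw [integral_finsetSum _ fun x _ => i4 x, le_div_iff₀ (by exact_mod_cast Fintype.card_pos)]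
  linarith

theorem sum_not_injective_haarMoment_le [Nonempty ι] :
    (∑ v : Fin t → ι with ¬ Function.Injective v, haarMoment ι t v v).re ≤
      3 * ((t : ℝ) ^ 2 / Fintype.card ι) := by
  refine (sum_not_injective_expect_le aestronglyMeasurable_sphere_apply
    (ae_of_all _ sum_norm_sq_sphere)).trans ?_
  calc (t : ℝ) ^ 2 * _ ≤ (t : ℝ) ^ 2 * (3 / Fintype.card ι) :=
        mul_le_mul_of_nonneg_left integral_sum_norm_pow_four_le (sq_nonneg _)
    _ = _ := by ring

/-- A state that is proportional to `injBlock` on injective tuples is close to the moment of a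
Haar-random state, up to its own weight on tuples with a collision. -/
theorem traceDist_haarMoment_le [Nonempty ι] {M : Matrix (Fin t → ι) (Fin t → ι) ℂ}
    (hM : M.PosSemidef) (htr : M.trace = 1) {c : ℝ}
    (hc : ∀ v w, Function.Injective v → M v w = c * injBlock ι t v w) :
    traceDist M (haarMoment ι t) ≤ (∑ v : Fin t → ι with ¬ Function.Injective v, M v v).re +
      3 * ((t : ℝ) ^ 2 / Fintype.card ι) := by
  obtain ⟨c', hc'⟩ := exists_haarMoment_eq_mul_injBlock (ι := ι) (t := t)
  refine (traceDist_le_of_block Function.Injective hM haarMoment_posSemidef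
    injBlock_posSemidef (fun v w hv => injBlock_eq_zero hv w) hc hc' htr trace_haarMoment).trans ?_
  exact add_le_add le_rfl sum_not_injective_haarMoment_le

end Haar

/-! ### Random binary phases. -/

section Sign

open scoped ComplexOrder

theorem prod_comp_eq_prod_pow_occ {ι : Type*} [Fintype ι] [DecidableEq ι] {t : ℕ} (f : ι → ℝ)
    (v : Fin t → ι) : ∏ i, f (v i) = ∏ x, f x ^ occ v x := by
  rw [← Finset.prod_fiberwise Finset.univ v]
  refine Finset.prod_congr rfl fun x _ => ?_
  rw [occ, ← Finset.prod_const]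
  exact Finset.prod_congr rfl fun i hi => by rw [(Finset.mem_filter.1 hi).2]

variable {Ω : Type*} [MeasurableSpace Ω] {P : Measure Ω}

variable {n t : ℕ}

theorem binaryPhaseState_apply (a : (Fin n → Bool) → ℝ) (x : Fin n → Bool) :
    binaryPhaseState a x = (((2 : ℝ) ^ (-(n : ℝ) / 2) * a x : ℝ) : ℂ) := by
  simp [binaryPhaseState, Finset.sum_apply, Pi.single_apply]

theorem norm_sq_binaryPhaseState_apply {a : (Fin n → Bool) → ℝ} {x : Fin n → Bool}
    (h : a x = 1 ∨ a x = -1) : ‖binaryPhaseState a x‖ ^ 2 = ((2 : ℝ) ^ n)⁻¹ := by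
  have h1 : a x ^ 2 = 1 := by rcases h with h | h <;> rw [h] <;> norm_num
  rw [binaryPhaseState_apply, Complex.norm_real, Real.norm_eq_abs, sq_abs, mul_pow, h1, mul_one,
    ← Real.rpow_natCast, ← Real.rpow_mul (by norm_num), ← Real.rpow_natCast, ← Real.rpow_neg
    (by norm_num)]
  congr 1
  push_cast
  ring

theorem sum_norm_sq_binaryPhaseState {a : (Fin n → Bool) → ℝ} (h : ∀ x, a x = 1 ∨ a x = -1) :
    ∑ x, ‖binaryPhaseState a x‖ ^ 2 = 1 := by
  rw [Finset.sum_congr rfl fun x _ => norm_sq_binaryPhaseState_apply (h x)]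
  simp

variable {α : (Fin n → Bool) → Ω → ℝ}

theorem aestronglyMeasurable_binaryPhaseState (hα : ∀ x, Measurable (α x)) (x : Fin n → Bool) :
    AEStronglyMeasurable (fun ω => binaryPhaseState (fun x => α x ω) x) P := by
  simp only [binaryPhaseState_apply]
  exact (Complex.measurable_ofReal.comp ((hα x).const_mul _)).aestronglyMeasurable

variable [IsProbabilityMeasure P]

theorem ae_eq_one_or_eq_neg_one {X : Ω → ℝ} (hX : Measurable X)
    (h : P {ω | X ω = 1} = 1 / 2 ∧ P {ω | X ω = -1} = 1 / 2) :
    ∀ᵐ ω ∂P, X ω = 1 ∨ X ω = -1 := by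
  have h1 : MeasurableSet {ω | X ω = 1} := hX (measurableSet_singleton 1)
  have h2 : MeasurableSet {ω | X ω = -1} := hX (measurableSet_singleton (-1))
  have hdisj : Disjoint {ω | X ω = 1} {ω | X ω = -1} := by
    rw [Set.disjoint_left]
    intro ω (ha : X ω = 1) (hb : X ω = -1)
    linarith
  have hu : P ({ω | X ω = 1} ∪ {ω | X ω = -1}) = 1 := by
    rw [measure_union hdisj h2, h.1, h.2, ENNReal.add_halves]
  exact (mem_ae_iff_prob_eq_one (h1.union h2)).2 hu

theorem integral_pow_eq_zero_of_odd {X : Ω → ℝ} (hX : Measurable X)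
    (h : P {ω | X ω = 1} = 1 / 2 ∧ P {ω | X ω = -1} = 1 / 2) {k : ℕ} (hk : Odd k) :
    ∫ ω, X ω ^ k ∂P = 0 := by
  have h1 : MeasurableSet {ω | X ω = 1} := hX (measurableSet_singleton 1)
  have h2 : MeasurableSet {ω | X ω = -1} := hX (measurableSet_singleton (-1))
  have hae : (fun ω => X ω ^ k) =ᵐ[P] fun ω =>
      {ω | X ω = 1}.indicator (fun _ => (1 : ℝ)) ω -
        {ω | X ω = -1}.indicator (fun _ => (1 : ℝ)) ω := by
    filter_upwards [ae_eq_one_or_eq_neg_one hX h] with ω hω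
    rcases hω with hω | hω
    · simp only [Set.indicator, Set.mem_ofPred_eq, hω]; norm_num
    · simp only [Set.indicator, Set.mem_ofPred_eq, hω, hk.neg_one_pow]; norm_num
  rw [integral_congr_ae hae, integral_sub ((integrable_const _).indicator h1)
    ((integrable_const _).indicator h2), integral_indicator_const _ h1,
    integral_indicator_const _ h2, measureReal_def, measureReal_def, h.1, h.2, sub_self]

theorem ae_forall_eq_one_or_eq_neg_one (hα : ∀ x, Measurable (α x))
    (hs : ∀ x, P {ω | α x ω = 1} = 1 / 2 ∧ P {ω | α x ω = -1} = 1 / 2) :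
    ∀ᵐ ω ∂P, ∀ x, α x ω = 1 ∨ α x ω = -1 :=
  ae_all_iff.2 fun x => ae_eq_one_or_eq_neg_one (hα x) (hs x)

/-- Grouping the signs by symbol, independence factorises the expectation, and the factor of `x` is
an odd moment of a symmetric sign. -/
theorem expect_binaryPhaseState_eq_zero_of_odd (hα : ∀ x, Measurable (α x)) (hi : iIndepFun α P)
    (hs : ∀ x, P {ω | α x ω = 1} = 1 / 2 ∧ P {ω | α x ω = -1} = 1 / 2)
    {v w : Fin t → Fin n → Bool} {x : Fin n → Bool} (h : ¬ Even (occ v x + occ w x)) :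
    expect P (fun ω => tensorPower t (pureState (binaryPhaseState fun x => α x ω))) v w = 0 := by
  have hentry : ∀ ω, tensorPower t (pureState (binaryPhaseState fun x => α x ω)) v w =
      (((∏ _i : Fin t, ((2 : ℝ) ^ (-(n : ℝ) / 2) * (2 : ℝ) ^ (-(n : ℝ) / 2))) *
        ∏ x, α x ω ^ (occ v x + occ w x) : ℝ) : ℂ) := by
    intro ω
    simp only [pow_add]
    rw [Finset.prod_mul_distrib (f := fun x => α x ω ^ occ v x), ← prod_comp_eq_prod_pow_occ
      (fun x => α x ω) v, ← prod_comp_eq_prod_pow_occ (fun x => α x ω) w,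
      ← Finset.prod_mul_distrib, ← Finset.prod_mul_distrib, tensorPower_pureState_apply,
      Complex.ofReal_prod]
    refine Finset.prod_congr rfl fun i _ => ?_
    rw [binaryPhaseState_apply, binaryPhaseState_apply, ← starRingEnd_apply, Complex.conj_ofReal,
      ← Complex.ofReal_mul]
    congr 1
    ring
  have hind : iIndepFun (fun x ω => α x ω ^ (occ v x + occ w x)) P :=
    hi.comp (fun x y => y ^ (occ v x + occ w x)) fun x => measurable_id.pow_const _
  rw [expect, Matrix.of_apply, integral_congr_ae (ae_of_all _ hentry), integral_complex_ofReal,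
    integral_const_mul, hind.integral_fun_prod_eq_prod_integral
      fun x => ((hα x).pow_const _).aestronglyMeasurable,
    Finset.prod_eq_zero (Finset.mem_univ x)
      (integral_pow_eq_zero_of_odd (hα x) (hs x) (Nat.not_even_iff_odd.1 h)), mul_zero,
    Complex.ofReal_zero]

theorem expect_binaryPhaseState_comp_perm (hα : ∀ x, Measurable (α x))
    (hs : ∀ x, P {ω | α x ω = 1} = 1 / 2 ∧ P {ω | α x ω = -1} = 1 / 2)
    (v : Fin t → Fin n → Bool) (σ : Equiv.Perm (Fin t)) :
    expect P (fun ω => tensorPower t (pureState (binaryPhaseState fun x => α x ω))) v (v ∘ σ) =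
      (((((2 : ℝ) ^ n)⁻¹) ^ t : ℝ) : ℂ) := by
  have h : ∫ ω, tensorPower t (pureState (binaryPhaseState fun x => α x ω)) v (v ∘ σ) ∂P =
      ∫ _, (((((2 : ℝ) ^ n)⁻¹) ^ t : ℝ) : ℂ) ∂P := by
    refine integral_congr_ae ?_
    filter_upwards [ae_forall_eq_one_or_eq_neg_one hα hs] with ω hω
    rw [tensorPower_pureState_comp_perm,
      Finset.prod_congr rfl fun i _ => norm_sq_binaryPhaseState_apply (hω (v i))]
    simp
  rw [expect, Matrix.of_apply, h]
  simp

theorem traceDist_binaryPhaseState_le (hα : ∀ x, Measurable (α x)) (hi : iIndepFun α P)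
    (hs : ∀ x, P {ω | α x ω = 1} = 1 / 2 ∧ P {ω | α x ω = -1} = 1 / 2) :
    traceDist
      (expect P fun ω => tensorPower t (pureState (binaryPhaseState fun x => α x ω)))
      (haarMoment (Fin n → Bool) t) ≤ 4 * ((t : ℝ) ^ 2 / 2 ^ n) := by
  have hm := aestronglyMeasurable_binaryPhaseState (P := P) hα
  have hn : ∀ᵐ ω ∂P, ∑ x, ‖binaryPhaseState (fun x => α x ω) x‖ ^ 2 = 1 := by
    filter_upwards [ae_forall_eq_one_or_eq_neg_one hα hs] with ω hω
    exact sum_norm_sq_binaryPhaseState hω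
  refine (traceDist_haarMoment_le (expect_tensorPower_posSemidef hm hn)
    (trace_expect_tensorPower hm hn) (eq_mul_injBlock
      (fun v w x _ hx => expect_binaryPhaseState_eq_zero_of_odd hα hi hs hx)
      fun v σ _ => expect_binaryPhaseState_comp_perm hα hs v σ)).trans ?_
  have h4 : ∫ ω, ∑ x, ‖binaryPhaseState (fun x => α x ω) x‖ ^ 4 ∂P = ((2 : ℝ) ^ n)⁻¹ := by
    have : ∫ ω, ∑ x, ‖binaryPhaseState (fun x => α x ω) x‖ ^ 4 ∂P =
        ∫ _, ((2 : ℝ) ^ n)⁻¹ ∂P := by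
      refine integral_congr_ae ?_
      filter_upwards [ae_forall_eq_one_or_eq_neg_one hα hs] with ω hω
      have h5 : ∀ x, ‖binaryPhaseState (fun x => α x ω) x‖ ^ 4 =
          (((2 : ℝ) ^ n)⁻¹) ^ 2 := fun x => by
        rw [← norm_sq_binaryPhaseState_apply (a := fun x => α x ω) (hω x), ← pow_mul]
      rw [Finset.sum_congr rfl fun x _ => h5 x]
      simp [sq]
    rw [this]
    simp
  -- The phase state contributes `1 * t² / 2ⁿ`; the other three units come from the Haar side.
  have hw := sum_not_injective_expect_le (t := t) hm hn
  rw [h4] at hw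
  have hcard : (Fintype.card (Fin n → Bool) : ℝ) = 2 ^ n := by simp
  rw [hcard]
  have : (t : ℝ) ^ 2 * ((2 : ℝ) ^ n)⁻¹ = (t : ℝ) ^ 2 / 2 ^ n := (div_eq_mul_inv _ _).symm
  linarith

end Sign

/-! ### Mixtures of binary type states. -/

section TypeState

open scoped ComplexOrder

variable {N t : ℕ}

theorem typeState_apply (T : Fin N → ℕ) (v : Fin t → Fin N) :
    typeState t T v = if typeOf v = T then ((Real.sqrt (ofType t T).card : ℂ))⁻¹ else 0 := by
  simp [typeState, ofType, Pi.single_apply]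

theorem pureState_typeState_apply (T : Fin N → ℕ) (v w : Fin t → Fin N) :
    pureState (typeState t T) v w =
      if typeOf v = T ∧ typeOf w = T then ((ofType t T).card : ℂ)⁻¹ else 0 := by
  have h : ((Real.sqrt (ofType t T).card : ℂ))⁻¹ * ((Real.sqrt (ofType t T).card : ℂ))⁻¹ =
      ((ofType t T).card : ℂ)⁻¹ := by
    rw [← mul_inv, ← Complex.ofReal_mul, Real.mul_self_sqrt (Nat.cast_nonneg _),
      Complex.ofReal_natCast]
  rw [pureState, Matrix.vecMulVec_apply, Pi.star_apply, typeState_apply, typeState_apply]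
  by_cases hv : typeOf v = T <;> by_cases hw : typeOf w = T <;>
    simp [hv, hw, h]

theorem trace_pureState_typeState {T : Fin N → ℕ} (hT : (ofType t T).Nonempty) :
    (pureState (typeState t T)).trace = 1 := by
  have hc : ((ofType t T).card : ℂ) ≠ 0 := by exact_mod_cast hT.card_pos.ne'
  simp only [Matrix.trace, Matrix.diag_apply, pureState_typeState_apply, and_self]
  rw [← Finset.sum_filter, Finset.sum_const, nsmul_eq_mul]
  exact mul_inv_cancel₀ hc

theorem ofType_nonempty {T : Fin N → Fin 2} (hT : T ∈ binaryTypes N t) :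
    (ofType t fun i => (T i : ℕ)).Nonempty := by
  have hcard : (Finset.univ.filter fun i => T i ≠ 0).card = t := (Finset.mem_filter.1 hT).2
  let v := (Finset.univ.filter fun i => T i ≠ 0).orderEmbOfFin hcard
  have hrange : ∀ i, (∃ j, v j = i) ↔ T i ≠ 0 := fun i => by
    have h := Set.ext_iff.1
      ((Finset.univ.filter fun i => T i ≠ 0).range_orderEmbOfFin hcard) i
    exact h.trans (by simp)
  refine ⟨v, Finset.mem_filter.2 ⟨Finset.mem_univ _, funext fun i => ?_⟩⟩
  by_cases h : T i = 0
  · rw [h]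
    refine Finset.card_eq_zero.2 (Finset.filter_eq_empty_iff.2 fun j _ hj => ?_)
    exact (hrange i).1 ⟨j, hj⟩ h
  · obtain ⟨j, rfl⟩ := (hrange i).2 h
    have h1 : T (v j) = 1 := by omega
    rw [h1]
    exact occ_apply_of_injective v.injective j

/-- The tuples of this type form the orbit of `v` under rearrangement, and the action on an
injective tuple is free. -/
theorem card_ofType_typeOf {v : Fin t → Fin N} (hv : Function.Injective v) :
    (ofType t (typeOf v)).card = t.factorial := by
  have himg : ofType t (typeOf v) =
      Finset.univ.image fun σ : Equiv.Perm (Fin t) => v ∘ σ := by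
    ext w
    simp only [ofType, Finset.mem_filter, Finset.mem_univ, true_and, Finset.mem_image]
    constructor
    · intro h
      obtain ⟨σ, hσ⟩ := exists_perm_of_even_occ (w := w) hv fun x =>
        ⟨occ v x, congrArg (occ v x + ·) (congrFun h x)⟩
      exact ⟨σ, hσ.symm⟩
    · rintro ⟨σ, rfl⟩
      exact occ_comp_perm v σ
  rw [himg, Finset.card_image_of_injective, Finset.card_univ, Fintype.card_perm, Fintype.card_fin]
  intro σ τ h
  exact Equiv.ext fun i => hv (congrFun h i)

theorem binaryTypes_nonempty (h : t ≤ N) : (binaryTypes N t).Nonempty := by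
  obtain ⟨s, -, hs⟩ := Finset.exists_subset_card_eq (s := (Finset.univ : Finset (Fin N)))
    (n := t) (by simpa using h)
  refine ⟨fun i => if i ∈ s then 1 else 0, Finset.mem_filter.2 ⟨Finset.mem_univ _, ?_⟩⟩
  rw [← hs, hammingNorm]
  congr 1
  ext i
  simp

theorem typeMixture_posSemidef : (typeMixture N t).PosSemidef := by
  refine Matrix.PosSemidef.smul (Matrix.posSemidef_sum _ fun T _ => ?_) (by positivity)
  exact Matrix.posSemidef_vecMulVec_self_star _

theorem trace_typeMixture (h : t ≤ N) : (typeMixture N t).trace = 1 := by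
  have hc : ((binaryTypes N t).card : ℂ) ≠ 0 := by
    exact_mod_cast (binaryTypes_nonempty h).card_pos.ne'
  rw [typeMixture, Matrix.trace_smul, Matrix.trace_sum,
    Finset.sum_congr rfl fun T hT => trace_pureState_typeState (ofType_nonempty hT)]
  simp [hc]

theorem typeMixture_apply (v w : Fin t → Fin N) :
    typeMixture N t v w = ((binaryTypes N t).card : ℂ)⁻¹ * ∑ T ∈ binaryTypes N t,
      if typeOf v = (fun i => (T i : ℕ)) ∧ typeOf w = (fun i => (T i : ℕ)) then
        ((ofType t fun i => (T i : ℕ)).card : ℂ)⁻¹ else 0 := by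
  simp [typeMixture, Matrix.sum_apply, pureState_typeState_apply]

theorem typeMixture_eq_zero_of_odd {v w : Fin t → Fin N} {x : Fin N}
    (h : ¬ Even (occ v x + occ w x)) : typeMixture N t v w = 0 := by
  rw [typeMixture_apply, Finset.sum_eq_zero, mul_zero]
  intro T _
  refine if_neg fun hT => h ⟨occ w x, ?_⟩
  exact congrArg (· + occ w x) (congrFun (hT.1.trans hT.2.symm) x)

/-- A repeated symbol has multiplicity at least 2, which no binary type allows. -/
theorem typeMixture_self_eq_zero {v : Fin t → Fin N} (hv : ¬ Function.Injective v) :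
    typeMixture N t v v = 0 := by
  rw [typeMixture_apply, Finset.sum_eq_zero, mul_zero]
  intro T _
  refine if_neg fun hT => ?_
  rw [Function.not_injective_iff] at hv
  obtain ⟨i, j, hij, hne⟩ := hv
  have h2 : 1 < typeOf v (v i) :=
    Finset.one_lt_card.2 ⟨i, by simp, j, by simp [hij], hne⟩
  rw [hT.1] at h2
  exact absurd (T (v i)).isLt (Nat.not_lt.2 h2)

theorem typeMixture_comp_perm {v : Fin t → Fin N} (hv : Function.Injective v)
    (σ : Equiv.Perm (Fin t)) : typeMixture N t v (v ∘ σ) =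
      ((((binaryTypes N t).card : ℝ)⁻¹ * (t.factorial : ℝ)⁻¹ : ℝ) : ℂ) := by
  have hle : ∀ i, typeOf v i < 2 := by
    intro i
    by_contra! h
    obtain ⟨a, ha, b, hb, hab⟩ := Finset.one_lt_card.1 (Nat.lt_of_succ_le h)
    exact hab (hv ((Finset.mem_filter.1 ha).2.trans (Finset.mem_filter.1 hb).2.symm))
  let T : Fin N → Fin 2 := fun i => ⟨typeOf v i, hle i⟩
  have hT : T ∈ binaryTypes N t := by
    refine Finset.mem_filter.2 ⟨Finset.mem_univ _, ?_⟩
    have himg : (Finset.univ.filter fun i => T i ≠ 0) = Finset.univ.image v := by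
      ext i
      simp [T, Fin.ext_iff, typeOf, Finset.filter_eq_empty_iff]
    rw [hammingNorm, himg, Finset.card_image_of_injective _ hv, Finset.card_univ,
      Fintype.card_fin]
  -- Only the indicator of the range of `v` contributes to the average.
  rw [typeMixture_apply, Finset.sum_eq_single T]
  · have h1 : typeOf (v ∘ σ) = fun i => (T i : ℕ) := occ_comp_perm v σ
    rw [if_pos ⟨rfl, h1⟩]
    have h2 : (ofType t fun i => (T i : ℕ)).card = t.factorial := card_ofType_typeOf hv
    rw [h2]
    push_cast
    rfl
  · intro T' _ hne
    refine if_neg fun h => hne (funext fun i => Fin.ext ?_)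
    exact (congrFun h.1 i).symm
  · exact fun h => absurd hT h

theorem traceDist_typeMixture_le (hN : 1 ≤ N) (ht : t ≤ N) :
    traceDist (typeMixture N t) (haarMoment (Fin N) t) ≤ 3 * ((t : ℝ) ^ 2 / N) := by
  have : Nonempty (Fin N) := ⟨⟨0, hN⟩⟩
  refine (traceDist_haarMoment_le typeMixture_posSemidef (trace_typeMixture ht) (eq_mul_injBlock
    (fun v w x _ hx => typeMixture_eq_zero_of_odd hx)
    fun v σ hv => typeMixture_comp_perm hv σ)).trans ?_
  rw [Finset.sum_eq_zero fun v hv => typeMixture_self_eq_zero (Finset.mem_filter.1 hv).2]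
  simp

end TypeState

end BinaryPhase

theorem mainTheorem1 :
    (∃ C : ℝ, ∀ (n t : ℕ) (Ω : Type*) [MeasurableSpace Ω] (P : Measure Ω)
      [IsProbabilityMeasure P] (α : (Fin n → Bool) → Ω → ℝ),
      (∀ x, Measurable (α x)) → iIndepFun α P →
      (∀ x, P {ω | α x ω = 1} = 1 / 2 ∧ P {ω | α x ω = -1} = 1 / 2) →
      BinaryPhase.traceDist
        (BinaryPhase.expect P fun ω => BinaryPhase.tensorPower t
          (BinaryPhase.pureState (BinaryPhase.binaryPhaseState fun x => α x ω)))
        (BinaryPhase.haarMoment (Fin n → Bool) t) ≤ C * ((t : ℝ) ^ 2 / 2 ^ n)) ∧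
    (∃ C : ℝ, ∀ N t : ℕ, 1 ≤ N → t ≤ N →
      BinaryPhase.traceDist (BinaryPhase.typeMixture N t) (BinaryPhase.haarMoment (Fin N) t)
        ≤ C * ((t : ℝ) ^ 2 / N)) :=
  ⟨⟨4, fun _ _ _ _ _ _ _ hα hi hs => BinaryPhase.traceDist_binaryPhaseState_le hα hi hs⟩,
    ⟨3, fun _ _ hN ht => BinaryPhase.traceDist_typeMixture_le hN ht⟩⟩
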